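/- Localization game on a finite graph $G$: a robber sits at an unknown vertex. In each round the cop, using all distances observed so far, chooses a set $W$ of at most $k$ vertices and is told the distances from the robber's vertex to all $w\in W$ (infinite between different components). The cop wins if all the information received so far determines the robber's current vertex; otherwise the robber moves to a neighbour and the next round begins. The localization number $\zeta(G)$ is the least $k$ for which the cop has a strategy that locates the robber after finitely many rounds, whatever the robber does. (A robber on an isolated vertex stays there. The result below holds both for this rule and for the rule under which the robber may also stay at his current vertex in any round.) Let $G_{n,p}$ be the binomial random graph on $n$ vertices with edge probability $p$, let $$\rho=p^2+(1-p)^2,\qquad \eta=\frac{\log(1/p)}{\log n},$$ and let $L_n=\left(1-2\eta-\frac{4\log\log n}{\log n}\right)\frac{2\log n}{\log(1/\rho)}$ and $U_n^{(c)}=(1-c\eta)\frac{2\log n}{\log(1/\rho)}$. Suppose that either (i) $p=p(n)=n^{-1/\omega}$ for all large $n$, where $\omega=\omega(n)\to\infty$ and $\omega=o(\log n)$; or (ii) $p\in(0,1)$ is a constant. Then $L_n=(1+o(1))\,U_n^{(c)}$ as $n\to\infty$ for every constant $c\in(0,1)$, and asymptotically almost surely $$\zeta(G_{n,p})\approx\frac{2\log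 n}{\log(1/\rho)},$$ that is, for every $\varepsilon>0$, $$\lim_{n\to\infty}\Pr\left(\left|\zeta(G_{n,p})-\frac{2\log n}{\log(1/\rho)}\right|\le\varepsilon\,\frac{2\log n}{\log(1/\rho)}\right)=1.$$ -/

import Mathlib

open Filter Topology Asymptotics

noncomputable section

namespace LocalizationGame

universe u
variable {V : Type u}

/-- The legal moves of the robber between two rounds. He moves along an edge; if `mayStay = true`
he may also remain where he is. A robber on an isolated vertex has nowhere to go, so there he
remains under both rules. -/
def RobberStep (G : SimpleGraph V) (mayStay : Bool) (a b : V) : Prop :=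
  G.Adj a b ∨ (a = b ∧ (mayStay = true ∨ ∀ w, ¬ G.Adj a w))

/-- A trajectory of the robber: `x t` is his position in round `t`. -/
def IsTrajectory (G : SimpleGraph V) (mayStay : Bool) (x : ℕ → V) : Prop :=
  ∀ t, RobberStep G mayStay (x t) (x (t + 1))

/-- The `W`-signature of `v`: the distance from `v` to `w`, for every `w ∈ W`.
The distance is `⊤` between different components. -/
def signature (G : SimpleGraph V) (W : Finset V) (v : V) : Set (V × ℕ∞) :=
  (fun w => (w, G.edist v w)) '' (W : Set V)

/-- A strategy of the cop chooses the next test set from the list of signatures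
that were observed in the previous rounds. -/
abbrev CopStrategy (V : Type u) : Type u := List (Set (V × ℕ∞)) → Finset V

/-- The signatures observed in the first `t` rounds (rounds `0, …, t - 1`), when the cop plays `σ`
and the robber follows `x`. -/
def transcript (G : SimpleGraph V) (σ : CopStrategy V) (x : ℕ → V) : ℕ → List (Set (V × ℕ∞))
  | 0 => []
  | t + 1 => transcript G σ x t ++ [signature G (σ (transcript G σ x t)) (x t)]

/-- After the test of round `t` the cop can determine the position of the robber: every trajectory
that explains all the signatures seen so far is at the same vertex in round `t`. -/
def LocatedAt (G : SimpleGraph V) (mayStay : Bool) (σ : CopStrategy V) (x : ℕ → V) (t : ℕ) : Prop :=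
  ∀ y, IsTrajectory G mayStay y → transcript G σ y (t + 1) = transcript G σ x (t + 1) → y t = x t

/-- The cop has a strategy with test sets of size at most `k` which eventually locates the robber,
whatever the robber does. -/
def CopWins (G : SimpleGraph V) (mayStay : Bool) (k : ℕ) : Prop :=
  ∃ σ : CopStrategy V, (∀ h, (σ h).card ≤ k) ∧
    ∀ x, IsTrajectory G mayStay x → ∃ t, LocatedAt G mayStay σ x t

/-- The localization number `ζ(G)`. -/
def localizationNumber (G : SimpleGraph V) (mayStay : Bool) : ℕ :=
  sInf {k | CopWins G mayStay k}

theorem signature_eq_iff (G : SimpleGraph V) (W : Finset V) (a b : V) :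
    signature G W a = signature G W b ↔ ∀ w ∈ W, G.edist a w = G.edist b w := by
  constructor
  · intro h w hw
    have h1 : (w, G.edist a w) ∈ signature G W b := h ▸ ⟨w, hw, rfl⟩
    obtain ⟨w', _, h2⟩ := h1
    simp only [Prod.mk.injEq] at h2
    obtain ⟨rfl, h3⟩ := h2
    exact h3.symm
  · intro h
    exact Set.image_congr fun w hw => by rw [h w hw]

/-- On a finite graph the cop wins by testing all vertices, so the infimum that defines the
localization number is attained. -/
theorem copWins_card [Fintype V] (G : SimpleGraph V) (mayStay : Bool) :
    CopWins G mayStay (Fintype.card V) := by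
  refine ⟨fun _ => Finset.univ, fun _ => Finset.card_univ.le, fun x _ => ⟨0, fun y _ h => ?_⟩⟩
  have h1 : signature G Finset.univ (y 0) = signature G Finset.univ (x 0) := by
    simpa [transcript] using h
  have h2 := (signature_eq_iff G _ _ _).1 h1 (x 0) (Finset.mem_univ _)
  rw [SimpleGraph.edist_self] at h2
  exact SimpleGraph.edist_eq_zero_iff.1 h2

/-- `ρ = p² + q²` with `q = 1 - p`. -/
def rho (p : ℝ) : ℝ := p ^ 2 + (1 - p) ^ 2

/-- `2 log n / log (1/ρ)`. -/
def mainTerm (p : ℝ) (n : ℕ) : ℝ := 2 * Real.log n / Real.log (1 / rho p)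

/-- `η = log (1/p) / log n`. -/
def eta (p : ℝ) (n : ℕ) : ℝ := Real.log (1 / p) / Real.log n

/-- `(1 - 2η - 4 log log n / log n) · 2 log n / log (1/ρ)`. -/
def lowerBound (p : ℝ) (n : ℕ) : ℝ :=
  (1 - 2 * eta p n - 4 * Real.log (Real.log n) / Real.log n) * mainTerm p n

/-- `(1 - cη) · 2 log n / log (1/ρ)`. -/
def upperBound (c p : ℝ) (n : ℕ) : ℝ := (1 - c * eta p n) * mainTerm p n

/-- `X(G_{n,p}) ≈ B_n` asymptotically almost surely: for each `ε > 0`, the probability that `X`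
differs from `B_n` by at most `ε |B_n|` tends to `1`. -/
def AasApprox (p : ℕ → unitInterval) (X : ∀ n : ℕ, SimpleGraph (Fin n) → ℝ) (B : ℕ → ℝ) : Prop :=
  ∀ ε : ℝ, 0 < ε →
    Tendsto (fun n : ℕ => SimpleGraph.binomialRandom (Fin n) (p n)
      {G : SimpleGraph (Fin n) | |X n G - B n| ≤ ε * |B n|}) atTop (𝓝 1)

end LocalizationGame

end

/-!
The localization number is compared with `B = 2 log n / log (1/ρ)`, for which `ρ ^ B = n⁻²`; the
number `ρ` is the probability that two vertices have the same adjacency to a third one. All that is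
used about `p` is that `p = n ^ (-o(1))` and that `p` stays away from `1`. The first also gives
`η → 0`, so that both bounds are equivalent to `B`.

*Upper bound.* Fix a set `W` of `⌊(1 + ε) B⌋` vertices. By the union bound over all pairs of
vertices outside `W`, any two of them are distinguished by their neighbours in `W`, with probability
at least `1 - 2 n ^ (-2ε)` (`binomialRandom_real_not_separating`). Then the test set `W` locates the
robber in the first round (`copWins_of_separating`).

*Lower bound.* Let `K = ⌊(1 - ε) B⌋ + 1`. With high probability the diameter is at most `2`, and for
every set `W` of `K` vertices each `a ∈ W` has two neighbours outside `W` with the same neighbours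
in `W`.
A robber who was at `a` can then move to one of two vertices that a test of fewer than `K` vertices
does not distinguish, so the cop never locates him (`not_copWins_of_hasTwins`).

The failure probability for one pair `(W, a)` has to be far below `n ^ (-K)`, and a second moment
bound would not suffice. The neighbourhoods in `W` of the vertices outside `W` are independent
samples of a distribution `π` on the subsets of `W`, and a repeated sample containing `a` is wanted.
If `x₁, …, xₘ` are `m` of these samples, without such a repetition, then `m` further samples all
avoid them with probability at most `exp (-m ∑ π (xᵢ))`, the sum over the `xᵢ` that contain `a`.
The expectation of this factors, and it is at most `exp (-m² r / (1 + m M))`, where `r` is the sum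
of `π ^ 2` over the sets that contain `a` and `M = max π` (`sum_no_repetition_le`). With
`r ≥ p² ρ ^ K`, `M ≤ ρ ^ (K/2)` and `m` of order `n`, the exponent is of order
`p² m ρ ^ (K/2) ≥ n ^ (ε - o(1))`, whereas `K log n = n ^ o(1)`.
-/

open Filter Topology Asymptotics

namespace LocalizationGame

/-! ### Finitely many edges of a binomial random graph -/

section Marginal

open MeasureTheory unitInterval

/-- The mass function of the Bernoulli distribution with success probability `p`. -/
noncomputable def bernoulliMass (p : ℝ) (b : Bool) : ℝ := if b then p else 1 - p

lemma bernoulliMass_nonneg {p : ℝ} (h0 : 0 ≤ p) (h1 : p ≤ 1) (b : Bool) :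
    0 ≤ bernoulliMass p b := by
  unfold bernoulliMass; split_ifs <;> linarith

lemma sum_bernoulliMass (p : ℝ) : ∑ b, bernoulliMass p b = 1 := by
  simp [bernoulliMass]

lemma sum_bernoulliMass_sq (p : ℝ) : ∑ b, bernoulliMass p b ^ 2 = rho p := by
  simp [bernoulliMass, rho]

open Classical in
/-- Which of the pairs `e k` are edges of `G`. -/
noncomputable def edgePattern {V κ : Type*} (e : κ → Sym2 V) (G : SimpleGraph V) (k : κ) : Bool :=
  decide (e k ∈ G.edgeSet)

lemma edgePattern_eq_true {V κ : Type*} {e : κ → Sym2 V} {G : SimpleGraph V} {k : κ} :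
    edgePattern e G k = true ↔ e k ∈ G.edgeSet := by
  simp [edgePattern]

lemma edgePattern_eq_iff {V κ : Type*} {e : κ → Sym2 V} {G : SimpleGraph V} {x : κ → Bool} :
    edgePattern e G = x ↔ ∀ k, e k ∈ G.edgeSet ↔ x k = true := by
  rw [funext_iff]
  exact forall_congr' fun k => by rw [Bool.eq_iff_iff, edgePattern_eq_true]

variable {V : Type*} {κ : Type*} [Fintype κ]

lemma measurableSet_edgePattern_eq (e : κ → Sym2 V) (x : κ → Bool) :
    MeasurableSet {G : SimpleGraph V | edgePattern e G = x} := by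
  simp only [edgePattern_eq_iff, Set.ofPred_forall]
  refine MeasurableSet.iInter fun k => ?_
  have h : MeasurableSet {G : SimpleGraph V | e k ∈ G.edgeSet} :=
    measurableSet_setOfPred.2 (measurable_set_iff.1 SimpleGraph.measurable_edgeSet (e k))
  cases x k
  · convert h.compl using 1
    ext G; simp
  · simpa using h

variable [Countable V]

lemma binomialRandom_real_edgePattern_eq (p : I) (e : κ → Sym2 V) (he : Function.Injective e)
    (hd : ∀ k, ¬ (e k).IsDiag) (x : κ → Bool) :
    (SimpleGraph.binomialRandom V p).real {G | edgePattern e G = x} =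
      ∏ k, bernoulliMass p (x k) := by
  classical
  set g : Sym2 V → Bool := fun s => if h : ∃ k, e k = s then x h.choose else false with hg
  have hge : ∀ k, g (e k) = x k := fun k => by
    have h : ∃ k', e k' = e k := ⟨k, rfl⟩
    simp only [hg, h, dif_pos]
    rw [he h.choose_spec]
  rw [measureReal_def, SimpleGraph.binomialRandom_eq_map, ProbabilityTheory.setBernoulli_eq_map,
    Measure.map_map (by fun_prop) (by fun_prop),
    Measure.map_apply (by fun_prop) (measurableSet_edgePattern_eq e x)]
  have hset : (SimpleGraph.fromEdgeSet ∘ fun P : Sym2 V → Prop => {i | P i}) ⁻¹'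
      {G : SimpleGraph V | edgePattern e G = x} =
      Set.pi (Finset.univ.image e : Finset (Sym2 V)) (fun s => {P : Prop | P ↔ g s = true}) := by
    ext P
    simp [edgePattern_eq_iff, hge, hd]
  rw [hset, Measure.infinitePi_pi _ (fun _ _ => by measurability),
    Finset.prod_image (fun a _ b _ h => he h), ENNReal.toReal_prod]
  refine Finset.prod_congr rfl fun k _ => ?_
  rw [hge]
  have hdk : e k ∈ (Sym2.diagSetᶜ : Set (Sym2 V)) := by simpa using hd k
  cases hx : x k <;> simp [hd k, bernoulliMass]

/-- Distinct pairs `e k` are edges independently with probability `p`, so the probability of an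
event that concerns only them is a finite sum of products. -/
lemma binomialRandom_real_edgePattern_mem (p : I) (e : κ → Sym2 V) (he : Function.Injective e)
    (hd : ∀ k, ¬ (e k).IsDiag) (Q : Finset (κ → Bool)) :
    (SimpleGraph.binomialRandom V p).real {G | edgePattern e G ∈ Q} =
      ∑ x ∈ Q, ∏ k, bernoulliMass p (x k) := by
  have h : {G : SimpleGraph V | edgePattern e G ∈ Q} =
      ⋃ x ∈ Q, {G | edgePattern e G = x} := by
    ext G; simp
  rw [h, measureReal_biUnion_finset]
  · exact Finset.sum_congr rfl fun x _ => binomialRandom_real_edgePattern_eq p e he hd x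
  · exact fun x _ y _ hxy => Set.disjoint_left.2 fun G hx hy => hxy (hx.symm.trans hy)
  · exact fun x _ => measurableSet_edgePattern_eq e x

variable {ι : Type*} [Fintype ι]

/-- The version of `binomialRandom_real_edgePattern_mem` for pairs that are arranged in rows. -/
lemma binomialRandom_real_rows_mem (p : I) (e : ι × κ → Sym2 V) (he : Function.Injective e)
    (hd : ∀ k, ¬ (e k).IsDiag) (Q : Finset (ι → κ → Bool)) :
    (SimpleGraph.binomialRandom V p).real {G | Function.curry (edgePattern e G) ∈ Q} =
      ∑ x ∈ Q, ∏ i, ∏ k, bernoulliMass p (x i k) := by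
  have h := binomialRandom_real_edgePattern_mem p e he hd
    (Q.map (Equiv.curry ι κ Bool).symm.toEmbedding)
  rw [Finset.sum_map] at h
  simp only [Fintype.prod_prod_type] at h
  refine Eq.trans ?_ h
  congr 1
  ext G
  simp only [Set.mem_ofPred_eq, Finset.mem_map_equiv]
  rfl

/-- The rows are independent. -/
lemma binomialRandom_real_forall_row_mem (p : I) (e : ι × κ → Sym2 V)
    (he : Function.Injective e) (hd : ∀ k, ¬ (e k).IsDiag) (Q : Finset (κ → Bool)) :
    (SimpleGraph.binomialRandom V p).real
        {G | ∀ i, Function.curry (edgePattern e G) i ∈ Q} =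
      (∑ c ∈ Q, ∏ k, bernoulliMass p (c k)) ^ Fintype.card ι := by
  classical
  have h := binomialRandom_real_rows_mem p e he hd (Fintype.piFinset fun _ => Q)
  simp only [Fintype.mem_piFinset] at h
  rw [h, ← Finset.card_univ, ← Finset.prod_const, Finset.prod_univ_sum]

end Marginal

/-! ### The birthday problem for two independent samples -/

section Birthday

variable {α A B : Type*} [Fintype α] [Fintype A] [Fintype B]

/-- The inner sum of the birthday bound: given the first sample `y`, which has no repetition in `S`,
each element of the second sample avoids the part of `y` in `S`. -/
lemma sum_sumElim_mem_le (π : α → ℝ) (hπ : ∀ c, 0 ≤ π c) (hπ1 : ∑ c, π c = 1)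
    (S : Finset α) (Q : Finset (A ⊕ B → α)) [DecidableEq α] [DecidableEq B]
    (hQ : ∀ x ∈ Q, ∀ i j, i ≠ j → x i ∈ S → x i ≠ x j) (y : A → α)
    [DecidablePred fun z : B → α => Sum.elim y z ∈ Q] :
    ∑ z : B → α with Sum.elim y z ∈ Q, ∏ j, π (z j) ≤
      ∏ i, Real.exp (-(Fintype.card B * if y i ∈ S then π (y i) else 0)) := by
  rcases (Finset.univ.filter fun z : B → α => Sum.elim y z ∈ Q).eq_empty_or_nonempty with h | h
  · rw [h, Finset.sum_empty]
    positivity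
  obtain ⟨z₀, hz₀⟩ := h
  have hy : Set.InjOn y (Finset.univ.filter fun i => y i ∈ S : Finset A) := by
    intro i hi j _ hij
    by_contra hne
    exact hQ _ (Finset.mem_filter.1 hz₀).2 (Sum.inl i) (Sum.inl j) (by simpa using hne)
      (by simpa using hi) (by simpa using hij)
  set T : Finset α := (Finset.univ.filter fun i => y i ∈ S).image y with hT
  have hTsum : ∑ c ∈ T, π c = ∑ i, if y i ∈ S then π (y i) else 0 := by
    rw [hT, Finset.sum_image hy, Finset.sum_filter]
  have hcompl : ∑ c ∈ Tᶜ, π c = 1 - ∑ c ∈ T, π c := by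
    rw [← hπ1, ← Finset.sum_add_sum_compl T π]; ring
  calc ∑ z : B → α with Sum.elim y z ∈ Q, ∏ j, π (z j)
      ≤ ∑ z ∈ Fintype.piFinset fun _ : B => Tᶜ, ∏ j, π (z j) := by
        refine Finset.sum_le_sum_of_subset_of_nonneg (fun z hz => ?_)
          fun z _ _ => Finset.prod_nonneg fun j _ => hπ _
        simp only [Fintype.mem_piFinset, Finset.mem_compl, hT, Finset.mem_image,
          Finset.mem_filter, Finset.mem_univ, true_and, not_exists, not_and]
        intro j i hi hij
        exact hQ _ (Finset.mem_filter.1 hz).2 (Sum.inl i) (Sum.inr j) (by simp) (by simpa using hi)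
          (by simpa using hij)
    _ = (1 - ∑ c ∈ T, π c) ^ Fintype.card B := by
        rw [← Finset.prod_univ_sum, Finset.prod_const, Finset.card_univ, hcompl]
    _ ≤ Real.exp (-∑ c ∈ T, π c) ^ Fintype.card B := by
        refine pow_le_pow_left₀ ?_ (by linarith [Real.add_one_le_exp (-∑ c ∈ T, π c)]) _
        rw [← hcompl]
        exact Finset.sum_nonneg fun c _ => hπ c
    _ = ∏ i, Real.exp (-(Fintype.card B * if y i ∈ S then π (y i) else 0)) := by
        rw [← Real.exp_sum, ← Real.exp_nat_mul, hTsum, Finset.sum_neg_distrib, ← Finset.mul_sum,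
          mul_neg]

/-- Two independent samples `x`, of sizes `|A|` and `|B|`, from the distribution `π` rarely avoid
repeating an element of `S`. Given the first sample, if it has no repetition in `S`, the second
one avoids its part in `S` with probability at most `exp (-|B| ∑ i, π (x i))`, where the sum is over
the `i` with `x i ∈ S`; the expectation of this bound is a product over `i`. -/
lemma sum_no_repetition_le (π : α → ℝ) (hπ : ∀ c, 0 ≤ π c) (hπ1 : ∑ c, π c = 1) (S : Finset α)
    {M : ℝ} (hM : ∀ c, π c ≤ M) (Q : Finset (A ⊕ B → α))
    (hQ : ∀ x ∈ Q, ∀ i j, i ≠ j → x i ∈ S → x i ≠ x j) :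
    ∑ x ∈ Q, ∏ i, π (x i) ≤
      Real.exp (-(Fintype.card A * (Fintype.card B * (∑ c ∈ S, π c ^ 2) /
        (1 + Fintype.card B * M)))) := by
  classical
  set b : ℝ := (Fintype.card B : ℝ)
  have hb0 : 0 ≤ b := Nat.cast_nonneg _
  set πS : α → ℝ := fun c => if c ∈ S then π c else 0 with hπS
  have hπS0 : ∀ c, 0 ≤ πS c := fun c => by
    simp only [hπS]; split_ifs <;> simp [hπ]
  have hπSM : ∀ c, πS c ≤ M := fun c => by
    simp only [hπS]; split_ifs
    exacts [hM c, (hπ c).trans (hM c)]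
  have hterm : ∀ c, π c * Real.exp (-(b * πS c)) ≤ π c - π c * (b * πS c / (1 + b * M)) := by
    intro c
    have h0 : 0 ≤ b * πS c := mul_nonneg hb0 (hπS0 c)
    have h1 : b * πS c ≤ b * M := mul_le_mul_of_nonneg_left (hπSM c) hb0
    -- `exp (-u) ≤ 1 / (1 + u) = 1 - u / (1 + u)`
    have h2 : Real.exp (-(b * πS c)) ≤ 1 - b * πS c / (1 + b * πS c) := by
      rw [Real.exp_neg, one_sub_div (by positivity), add_sub_cancel_right, ← one_div]
      exact one_div_le_one_div_of_le (by positivity) (by linarith [Real.add_one_le_exp (b * πS c)])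
    have h3 : b * πS c / (1 + b * M) ≤ b * πS c / (1 + b * πS c) := by gcongr
    nlinarith [hπ c]
  have hsum : ∑ c, π c * (b * πS c / (1 + b * M)) = b * (∑ c ∈ S, π c ^ 2) / (1 + b * M) := by
    rw [Finset.mul_sum, Finset.sum_div, ← Finset.univ_inter S, ← Finset.sum_ite_mem]
    refine Finset.sum_congr rfl fun c _ => ?_
    simp only [hπS]
    split_ifs <;> ring
  calc ∑ x ∈ Q, ∏ i, π (x i)
      = ∑ y : A → α, ∑ z : B → α,
          if Sum.elim y z ∈ Q then (∏ i, π (y i)) * ∏ j, π (z j) else 0 := by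
        rw [← Finset.univ_inter Q, ← Finset.sum_ite_mem,
          ← (Equiv.sumArrowEquivProdArrow A B α).symm.sum_comp, Fintype.sum_prod_type]
        refine Finset.sum_congr rfl fun y _ => Finset.sum_congr rfl fun z _ => ?_
        simp [Equiv.sumArrowEquivProdArrow]
    _ ≤ ∑ y : A → α, (∏ i, π (y i)) * ∏ i, Real.exp (-(b * πS (y i))) := by
        refine Finset.sum_le_sum fun y _ => ?_
        rw [← Finset.sum_filter, ← Finset.mul_sum]
        exact mul_le_mul_of_nonneg_left (sum_sumElim_mem_le π hπ hπ1 S Q hQ y)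
          (Finset.prod_nonneg fun i _ => hπ _)
    _ = (∑ c, π c * Real.exp (-(b * πS c))) ^ Fintype.card A := by
        simp_rw [← Finset.prod_mul_distrib]
        rw [← Finset.card_univ, ← Finset.prod_const, Finset.prod_univ_sum, Fintype.piFinset_univ]
    _ ≤ Real.exp (-(b * (∑ c ∈ S, π c ^ 2) / (1 + b * M))) ^ Fintype.card A := by
        refine pow_le_pow_left₀ (Finset.sum_nonneg fun c _ =>
          mul_nonneg (hπ c) (Real.exp_nonneg _)) ?_ _
        refine (Finset.sum_le_sum fun c _ => hterm c).trans ?_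
        rw [Finset.sum_sub_distrib, hπ1, hsum]
        linarith [Real.add_one_le_exp (-(b * (∑ c ∈ S, π c ^ 2) / (1 + b * M)))]
    _ = _ := by rw [← Real.exp_nat_mul, mul_neg]

end Birthday

/-! ### Winning and losing positions of the cop -/

section Game

variable {V : Type*}

lemma transcript_congr (G : SimpleGraph V) (σ : CopStrategy V) {x y : ℕ → V} {t : ℕ}
    (h : ∀ i < t, x i = y i) : transcript G σ x t = transcript G σ y t := by
  induction t with
  | zero => rfl
  | succ t ih =>
    simp only [transcript]
    rw [ih fun i hi => h i (by omega), h t (by omega)]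

/-- If any two vertices outside `W` are distinguished by their neighbours in `W`, then the test set
`W` locates the robber in the first round. -/
lemma copWins_of_separating {G : SimpleGraph V} (mayStay : Bool) {W : Finset V}
    (hW : ∀ u v, u ≠ v → u ∉ W → v ∉ W → ∃ w ∈ W, ¬ (G.Adj u w ↔ G.Adj v w)) :
    CopWins G mayStay W.card := by
  refine ⟨fun _ => W, fun _ => le_rfl, fun x _ => ⟨0, fun y _ h => ?_⟩⟩
  have h1 : signature G W (y 0) = signature G W (x 0) := by
    simpa [transcript] using h
  rw [signature_eq_iff] at h1
  by_contra hne
  by_cases hy : y 0 ∈ W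
  · have h2 := h1 _ hy
    rw [SimpleGraph.edist_self, eq_comm, SimpleGraph.edist_eq_zero_iff] at h2
    exact hne h2.symm
  by_cases hx : x 0 ∈ W
  · have h2 := h1 _ hx
    rw [SimpleGraph.edist_self, SimpleGraph.edist_eq_zero_iff] at h2
    exact hne h2
  obtain ⟨w, hw, hadj⟩ := hW _ _ hne hy hx
  refine hadj ?_
  rw [← SimpleGraph.edist_eq_one_iff_adj, ← SimpleGraph.edist_eq_one_iff_adj, h1 w hw]

/-- If for every test set of size at most `k` each vertex `a` has two neighbours that the test does
not distinguish, then the robber always moves to one of them, and could as well have moved to the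
other. -/
lemma not_copWins_of_indistinguishable [Nonempty V] {G : SimpleGraph V} (mayStay : Bool) {k : ℕ}
    (h : ∀ W : Finset V, W.card ≤ k → ∀ a, ∃ u v, u ≠ v ∧ G.Adj a u ∧ G.Adj a v ∧
      ∀ w ∈ W, G.edist u w = G.edist v w) :
    ¬ CopWins G mayStay k := by
  rintro ⟨σ, hσ, hwin⟩
  have h' : ∀ (l : List (Set (V × ℕ∞))) (a : V), ∃ u v, u ≠ v ∧ G.Adj a u ∧ G.Adj a v ∧
      ∀ w ∈ σ l, G.edist u w = G.edist v w := fun l a => h (σ l) (hσ l) a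
  choose u v huv hu hv heq using h'
  obtain ⟨a₀⟩ := ‹Nonempty V›
  -- the position before round `t` (a fictitious one for `t = 0`) and the transcript up to round `t`
  let s : ℕ → V × List (Set (V × ℕ∞)) := fun t => Nat.rec (a₀, [])
    (fun _ q => (u q.2 q.1, q.2 ++ [signature G (σ q.2) (u q.2 q.1)])) t
  let x : ℕ → V := fun t => (s (t + 1)).1
  have hs : ∀ t, transcript G σ x t = (s t).2 := by
    intro t
    induction t with
    | zero => rfl
    | succ t ih =>
      simp only [transcript]
      rw [ih]
  have hx : IsTrajectory G mayStay x := fun t => Or.inl (hu _ _)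
  obtain ⟨t, ht⟩ := hwin x hx
  -- the alternative trajectory branches off in round `t` and then continues arbitrarily
  let y : ℕ → V := fun i => if i < t then x i else (u [])^[i - t] (v (s t).2 (s t).1)
  have hyt : y t = v (s t).2 (s t).1 := by simp [y]
  have hyx : ∀ i < t, y i = x i := fun i hi => by simp [y, hi]
  have hy : IsTrajectory G mayStay y := by
    intro i
    rcases lt_trichotomy (i + 1) t with hi | hi | hi
    · rw [hyx i (by omega), hyx (i + 1) hi]
      exact hx i
    · rw [hyx i (by omega)]
      subst hi
      rw [hyt]
      exact Or.inl (hv _ _)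
    · have h1 : y i = (u [])^[i - t] (v (s t).2 (s t).1) := by
        simp only [y]; rw [if_neg (by omega)]
      have h2 : y (i + 1) = u [] (y i) := by
        rw [h1, ← Function.iterate_succ_apply' (u [])]
        simp only [y]
        rw [if_neg (by omega), Nat.succ_eq_add_one, show i + 1 - t = i - t + 1 by omega]
      rw [h2]
      exact Or.inl (hu _ _)
  refine huv (s t).2 (s t).1 ?_
  have hfin := ht y hy ?_
  · rw [hyt] at hfin
    exact hfin.symm
  · simp only [transcript]
    rw [transcript_congr G σ hyx, hs t, hyt]
    congr 2
    exact (signature_eq_iff _ _ _ _).2 fun w hw => (heq _ _ w hw).symm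

/-- `a` has two neighbours outside `W` which have the same neighbours in `W`. -/
def HasTwins (G : SimpleGraph V) (W : Finset V) (a : V) : Prop :=
  ∃ u v, u ≠ v ∧ u ∉ W ∧ v ∉ W ∧ G.Adj u a ∧ G.Adj v a ∧ ∀ w ∈ W, (G.Adj u w ↔ G.Adj v w)

/-- In a graph of diameter at most `2`, twins are at the same distances from the test set. -/
lemma not_copWins_of_hasTwins [Fintype V] {G : SimpleGraph V} (mayStay : Bool) {k K : ℕ}
    (hkK : k < K) (hK : K ≤ Fintype.card V)
    (hdiam : ∀ u v, u ≠ v → (G.commonNeighbors u v).Nonempty)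
    (htwin : ∀ W : Finset V, W.card = K → ∀ a ∈ W, HasTwins G W a) :
    ¬ CopWins G mayStay k := by
  classical
  have : Nonempty V := Fintype.card_pos_iff.1 (by omega)
  refine not_copWins_of_indistinguishable mayStay fun W hW a => ?_
  obtain ⟨W', hWW', -, hW'⟩ := Finset.exists_subsuperset_card_eq (Finset.subset_univ (insert a W))
    ((Finset.card_insert_le a W).trans (show W.card + 1 ≤ K by omega)) (by simpa using hK)
  obtain ⟨u, v, huv, hu, hv, hua, hva, hw⟩ := htwin W' hW' a (hWW' (Finset.mem_insert_self a W))
  refine ⟨u, v, huv, hua.symm, hva.symm, fun w hwW => ?_⟩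
  have hwW' : w ∈ W' := hWW' (Finset.mem_insert_of_mem hwW)
  have hdist : ∀ z, z ∉ W' → G.edist z w = if G.Adj z w then 1 else 2 := fun z hz => by
    have hzw : z ≠ w := fun h => hz (h ▸ hwW')
    split_ifs with hadj
    · exact SimpleGraph.edist_eq_one_iff_adj.2 hadj
    · exact SimpleGraph.edist_eq_two_iff.2 ⟨hzw, hadj, hdiam z w hzw⟩
  rw [hdist u hu, hdist v hv]
  simp only [hw w hwW']

end Game

/-! ### Probabilities of the exceptional graphs -/

section Probability

open MeasureTheory unitInterval

lemma rho_nonneg (p : ℝ) : 0 ≤ rho p := by unfold rho; positivity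

lemma half_le_rho (p : ℝ) : 1 / 2 ≤ rho p := by
  unfold rho; nlinarith [sq_nonneg (2 * p - 1)]

lemma rho_le_one {p : ℝ} (h0 : 0 ≤ p) (h1 : p ≤ 1) : rho p ≤ 1 := by
  unfold rho; nlinarith

variable {V : Type*}

lemma injective_pair_left {ι : Type*} {W : Finset V} {f : ι → V} (hf : Function.Injective f)
    (hfW : ∀ i, f i ∉ W) : Function.Injective fun q : ι × W => s(f q.1, (q.2 : V)) := by
  rintro ⟨i, w⟩ ⟨j, z⟩ h
  simp only [Sym2.eq_iff] at h
  rcases h with ⟨h1, h2⟩ | ⟨h1, h2⟩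
  · exact Prod.ext (hf h1) (Subtype.ext h2)
  · exact absurd (h1 ▸ z.2) (hfW i)

lemma sum_pair (p : ℝ) (q : Bool → Bool → Prop) [DecidableRel q] :
    ∑ c : Bool → Bool with q (c true) (c false), ∏ k, bernoulliMass p (c k) =
      ∑ b, ∑ d, if q b d then bernoulliMass p b * bernoulliMass p d else 0 := by
  rw [Finset.sum_filter, ← (Equiv.boolArrowEquivProd Bool).symm.sum_comp, Fintype.sum_prod_type,
    Finset.sum_comm]
  simp [Equiv.boolArrowEquivProd]

variable [Fintype V]

/-- The adjacencies of two vertices `u`, `v` outside `W` to the elements of `W` form independent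
pairs. -/
lemma binomialRandom_real_forall_pair (p : I) {W : Finset V} {u v : V} (huv : u ≠ v) (hu : u ∉ W)
    (hv : v ∉ W) (q : Bool → Bool → Prop) [DecidableRel q] :
    (SimpleGraph.binomialRandom V p).real
        {G | ∀ w ∈ W, q (edgePattern (fun w => s(u, w)) G w) (edgePattern (fun w => s(v, w)) G w)} =
      (∑ b, ∑ d, if q b d then bernoulliMass p b * bernoulliMass p d else 0) ^ W.card := by
  set f : Bool → V := fun b => if b then u else v
  have hfW : ∀ b, f b ∉ W := by rintro (_ | _) <;> simpa [f]
  have hf : Function.Injective f := by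
    rintro (_ | _) (_ | _) <;> simp [f, huv, huv.symm]
  have h := binomialRandom_real_forall_row_mem p (fun k : W × Bool => s(f k.2, (k.1 : V)))
    ((injective_pair_left hf hfW).comp Prod.swap_injective)
    (fun k hk => hfW k.2 (by rw [Sym2.mk_isDiag_iff.1 hk]; exact k.1.2))
    (Finset.univ.filter fun c => q (c true) (c false))
  rw [sum_pair, Fintype.card_coe] at h
  rw [← h]
  congr 1
  ext G
  simp [edgePattern, Function.curry, f]

/-- The union bound for the test set `W`. -/
lemma binomialRandom_real_not_separating (p : I) (W : Finset V) :
    (SimpleGraph.binomialRandom V p).real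
        {G | ¬ ∀ u v, u ≠ v → u ∉ W → v ∉ W → ∃ w ∈ W, ¬ (G.Adj u w ↔ G.Adj v w)} ≤
      (Fintype.card V : ℝ) ^ 2 * rho p ^ W.card := by
  classical
  have hsub : {G : SimpleGraph V | ¬ ∀ u v, u ≠ v → u ∉ W → v ∉ W →
      ∃ w ∈ W, ¬ (G.Adj u w ↔ G.Adj v w)} ⊆
      ⋃ q ∈ (Finset.univ.filter fun q : V × V => q.1 ≠ q.2 ∧ q.1 ∉ W ∧ q.2 ∉ W),
        {G | ∀ w ∈ W,
          edgePattern (fun w => s(q.1, w)) G w = edgePattern (fun w => s(q.2, w)) G w} := by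
    intro G hG
    simp only [Set.mem_ofPred_eq, not_forall, not_exists, not_and, not_not] at hG
    obtain ⟨u, v, huv, hu, hv, hw⟩ := hG
    simp only [Set.mem_iUnion]
    refine ⟨(u, v), by simp [huv, hu, hv], fun w hwW => ?_⟩
    rw [Bool.eq_iff_iff, edgePattern_eq_true, edgePattern_eq_true]
    exact hw w hwW
  refine (measureReal_mono hsub (measure_ne_top _ _)).trans
    ((measureReal_biUnion_finset_le _ _).trans ?_)
  have hle : ∀ q ∈ (Finset.univ.filter fun q : V × V => q.1 ≠ q.2 ∧ q.1 ∉ W ∧ q.2 ∉ W),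
      (SimpleGraph.binomialRandom V p).real {G | ∀ w ∈ W,
        edgePattern (fun w => s(q.1, w)) G w = edgePattern (fun w => s(q.2, w)) G w} ≤
      rho p ^ W.card := by
    intro q hq
    obtain ⟨-, h1, h2, h3⟩ := Finset.mem_filter.1 hq
    rw [binomialRandom_real_forall_pair p h1 h2 h3 (fun b d => b = d)]
    simp [bernoulliMass, rho, sq]
  refine (Finset.sum_le_card_nsmul _ _ _ hle).trans ?_
  rw [nsmul_eq_mul]
  refine mul_le_mul_of_nonneg_right ?_ (pow_nonneg (rho_nonneg p) _)
  have := Finset.card_filter_le (Finset.univ : Finset (V × V))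
    (fun q : V × V => q.1 ≠ q.2 ∧ q.1 ∉ W ∧ q.2 ∉ W)
  rw [Finset.card_univ, Fintype.card_prod, ← sq] at this
  exact_mod_cast this

/-- The union bound for the diameter. -/
lemma binomialRandom_real_not_commonNeighbors (p : I) :
    (SimpleGraph.binomialRandom V p).real
        {G | ¬ ∀ u v, u ≠ v → (G.commonNeighbors u v).Nonempty} ≤
      (Fintype.card V : ℝ) ^ 2 * (1 - (p : ℝ) ^ 2) ^ (Fintype.card V - 2) := by
  classical
  have hsub : {G : SimpleGraph V | ¬ ∀ u v, u ≠ v → (G.commonNeighbors u v).Nonempty} ⊆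
      ⋃ q ∈ (Finset.univ.filter fun q : V × V => q.1 ≠ q.2),
        {G | ∀ w ∈ ({q.1, q.2}ᶜ : Finset V), ¬ (edgePattern (fun w => s(q.1, w)) G w = true ∧
          edgePattern (fun w => s(q.2, w)) G w = true)} := by
    intro G hG
    simp only [Set.mem_ofPred_eq, not_forall] at hG
    obtain ⟨u, v, huv, hw⟩ := hG
    simp only [Set.mem_iUnion]
    refine ⟨(u, v), by simp [huv], fun w _ => ?_⟩
    rw [edgePattern_eq_true, edgePattern_eq_true]
    exact fun h => hw ⟨w, h⟩
  refine (measureReal_mono hsub (measure_ne_top _ _)).trans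
    ((measureReal_biUnion_finset_le _ _).trans ?_)
  have hp0 := p.2.1
  have hp1 := p.2.2
  have hle : ∀ q ∈ (Finset.univ.filter fun q : V × V => q.1 ≠ q.2),
      (SimpleGraph.binomialRandom V p).real {G | ∀ w ∈ ({q.1, q.2}ᶜ : Finset V),
        ¬ (edgePattern (fun w => s(q.1, w)) G w = true ∧
          edgePattern (fun w => s(q.2, w)) G w = true)} ≤
      (1 - (p : ℝ) ^ 2) ^ (Fintype.card V - 2) := by
    intro q hq
    have h1 := (Finset.mem_filter.1 hq).2
    rw [binomialRandom_real_forall_pair p h1 (by simp) (by simp)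
      (fun b d => ¬ (b = true ∧ d = true)), Finset.card_compl, Finset.card_pair h1]
    refine le_of_eq (congrArg (· ^ (Fintype.card V - 2)) ?_)
    simp [bernoulliMass]
    ring
  refine (Finset.sum_le_card_nsmul _ _ _ hle).trans ?_
  rw [nsmul_eq_mul]
  refine mul_le_mul_of_nonneg_right ?_ (pow_nonneg (by nlinarith) _)
  have := Finset.card_filter_le (Finset.univ : Finset (V × V)) (fun q : V × V => q.1 ≠ q.2)
  rw [Finset.card_univ, Fintype.card_prod, ← sq] at this
  exact_mod_cast this

/-- For fixed `W` and `a ∈ W`, the neighbourhoods in `W` of `2 m` vertices outside `W` are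
independent samples, to which the birthday bound applies: two samples that contain `a` coincide with
probability at least `p ^ 2 * ρ ^ |W|`. -/
lemma binomialRandom_real_not_hasTwins (p : I) {W : Finset V} {a : V} (ha : a ∈ W) {m : ℕ}
    (hm : 2 * m + W.card ≤ Fintype.card V) (hmρ : 1 ≤ m * √(rho p ^ W.card)) :
    (SimpleGraph.binomialRandom V p).real {G | ¬ HasTwins G W a} ≤
      Real.exp (-((p : ℝ) ^ 2 * (m * √(rho p ^ W.card)) / 2)) := by
  classical
  have hp0 : 0 ≤ (p : ℝ) := p.2.1
  have hp1 : (p : ℝ) ≤ 1 := p.2.2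
  obtain ⟨f⟩ : Nonempty (Fin m ⊕ Fin m ↪ (Wᶜ : Finset V)) := by
    rw [Function.Embedding.nonempty_iff_card_le, Fintype.card_coe, Finset.card_compl]
    simp only [Fintype.card_sum, Fintype.card_fin]
    omega
  have hfW : ∀ i, (f i : V) ∉ W := fun i => Finset.mem_compl.1 (f i).2
  set π : (W → Bool) → ℝ := fun c => ∏ w, bernoulliMass p (c w) with hπ
  have hπ0 : ∀ c, 0 ≤ π c := fun c => Finset.prod_nonneg fun w _ => bernoulliMass_nonneg hp0 hp1 _
  have hπ1 : ∑ c, π c = 1 := by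
    simp only [hπ]
    rw [← Fintype.piFinset_univ, ← Finset.prod_univ_sum]
    simp [sum_bernoulliMass, -Fintype.univ_bool]
  have hπ2 : ∑ c, π c ^ 2 = rho p ^ W.card := by
    simp only [hπ, ← Finset.prod_pow]
    rw [← Fintype.piFinset_univ,
      ← Finset.prod_univ_sum (fun _ : W => Finset.univ) (fun _ b => bernoulliMass p b ^ 2)]
    simp [sum_bernoulliMass_sq, -Fintype.univ_bool]
  set S : Finset (W → Bool) := Finset.univ.filter fun c => c ⟨a, ha⟩ = true with hS
  have hπS : (p : ℝ) ^ 2 * rho p ^ W.card ≤ ∑ c ∈ S, π c ^ 2 := by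
    have hS' : S = Fintype.piFinset fun w => if w = ⟨a, ha⟩ then {true} else Finset.univ := by
      ext c
      simp only [hS, Finset.mem_filter, Finset.mem_univ, true_and, Fintype.mem_piFinset]
      refine ⟨fun h w => ?_, fun h => by simpa using h ⟨a, ha⟩⟩
      split_ifs with hw
      · simp [hw, h]
      · simp
    simp only [hπ, ← Finset.prod_pow]
    rw [hS', ← Finset.prod_univ_sum _ (fun _ b => bernoulliMass p b ^ 2)]
    calc (p : ℝ) ^ 2 * rho p ^ W.card
        = ∏ w : W, (if w = ⟨a, ha⟩ then (p : ℝ) ^ 2 else 1) * rho p := by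
          rw [Finset.prod_mul_distrib]; simp
      _ ≤ _ := by
          refine Finset.prod_le_prod (fun w _ => ?_) fun w _ => ?_
          · have := rho_nonneg p
            split_ifs <;> positivity
          · split_ifs
            · simpa [bernoulliMass] using mul_le_of_le_one_right (sq_nonneg (p : ℝ))
                (rho_le_one hp0 hp1)
            · rw [sum_bernoulliMass_sq, one_mul]
  have hM : ∀ c, π c ≤ √(rho p ^ W.card) := fun c => by
    refine Real.le_sqrt_of_sq_le ?_
    rw [← hπ2]
    exact Finset.single_le_sum (f := fun c => π c ^ 2) (fun c _ => sq_nonneg _) (Finset.mem_univ c)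
  set Q : Finset (Fin m ⊕ Fin m → W → Bool) := Finset.univ.filter fun x =>
    ∀ i j, i ≠ j → x i ∈ S → x i ≠ x j with hQ
  have hsub : {G : SimpleGraph V | ¬ HasTwins G W a} ⊆ {G | Function.curry
      (edgePattern (fun q : (Fin m ⊕ Fin m) × W => s((f q.1 : V), (q.2 : V))) G) ∈ Q} := by
    intro G hG
    simp only [hQ, Set.mem_ofPred_eq, Finset.mem_filter, Finset.mem_univ, true_and]
    intro i j hij hi h
    refine hG ⟨f i, f j, fun h' => hij (f.injective (Subtype.ext h')), hfW i, hfW j, ?_, ?_, ?_⟩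
    · simpa [hS, Function.curry, edgePattern] using hi
    · rw [h] at hi
      simpa [hS, Function.curry, edgePattern] using hi
    · intro w hw
      have := congrFun h ⟨w, hw⟩
      simpa [Function.curry, edgePattern] using this
  refine (measureReal_mono hsub).trans ?_
  rw [binomialRandom_real_rows_mem p _
    (injective_pair_left (f := fun i => (f i : V)) (Subtype.val_injective.comp f.injective) hfW)
    (fun q hq => hfW q.1 (by rw [Sym2.mk_isDiag_iff.1 hq]; exact q.2.2))]
  refine (sum_no_repetition_le π hπ0 hπ1 S hM Q fun x hx => (Finset.mem_filter.1 hx).2).trans ?_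
  rw [Fintype.card_fin, Real.exp_le_exp, neg_le_neg_iff]
  set y := √(rho p ^ W.card) with hy
  have hy2 : y ^ 2 = rho p ^ W.card := Real.sq_sqrt (pow_nonneg (rho_nonneg p) _)
  have hy0 : 0 ≤ y := Real.sqrt_nonneg _
  rw [← hy2] at hπS
  rw [← mul_div_assoc, div_le_div_iff₀ (by norm_num) (by positivity)]
  have hm0 : (0 : ℝ) ≤ m := Nat.cast_nonneg _
  calc (p : ℝ) ^ 2 * (m * y) * (1 + m * y) ≤ (p : ℝ) ^ 2 * (m * y) * (m * y + m * y) := by gcongr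
    _ = m * (m * ((p : ℝ) ^ 2 * y ^ 2)) * 2 := by ring
    _ ≤ _ := by gcongr

/-- The union bound over all `W` and `a`. -/
lemma binomialRandom_real_not_forall_hasTwins (p : I) {K m : ℕ}
    (hm : 2 * m + K ≤ Fintype.card V) (hmρ : 1 ≤ m * √(rho p ^ K)) :
    (SimpleGraph.binomialRandom V p).real
        {G | ¬ ∀ W : Finset V, W.card = K → ∀ a ∈ W, HasTwins G W a} ≤
      (Fintype.card V : ℝ) ^ (K + 1) * Real.exp (-((p : ℝ) ^ 2 * (m * √(rho p ^ K)) / 2)) := by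
  classical
  set T : Finset (Finset V × V) :=
    (Finset.univ.powersetCard K ×ˢ Finset.univ).filter fun q => q.2 ∈ q.1 with hT
  have hsub : {G : SimpleGraph V | ¬ ∀ W : Finset V, W.card = K → ∀ a ∈ W, HasTwins G W a} ⊆
      ⋃ q ∈ T, {G | ¬ HasTwins G q.1 q.2} := by
    intro G hG
    simp only [Set.mem_ofPred_eq, not_forall] at hG
    obtain ⟨W, hW, a, ha, h⟩ := hG
    simp only [Set.mem_iUnion]
    exact ⟨(W, a), by simp [hT, hW, ha], h⟩
  refine (measureReal_mono hsub (measure_ne_top _ _)).trans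
    ((measureReal_biUnion_finset_le _ _).trans ?_)
  refine (Finset.sum_le_card_nsmul _ _ _ fun q hq => ?_).trans (b :=
    T.card • Real.exp (-((p : ℝ) ^ 2 * (m * √(rho p ^ K)) / 2))) ?_
  · obtain ⟨hq1, hq2⟩ := Finset.mem_filter.1 hq
    have hq3 : q.1.card = K := (Finset.mem_powersetCard.1 (Finset.mem_product.1 hq1).1).2
    rw [← hq3] at hm hmρ ⊢
    exact binomialRandom_real_not_hasTwins p hq2 hm hmρ
  · rw [nsmul_eq_mul]
    refine mul_le_mul_of_nonneg_right ?_ (Real.exp_nonneg _)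
    have h1 : T.card ≤ Fintype.card V ^ K * Fintype.card V := by
      refine (Finset.card_filter_le _ _).trans ?_
      rw [Finset.card_product, Finset.card_powersetCard, Finset.card_univ]
      exact Nat.mul_le_mul_right _ (Nat.choose_le_pow _ _)
    rw [pow_succ]
    exact_mod_cast h1

end Probability

/-! ### The two bounds on the localization number -/

section Bounds

open MeasureTheory unitInterval

lemma rho_lt_one {p : ℝ} (h0 : 0 < p) (h1 : p < 1) : rho p < 1 := by
  unfold rho; nlinarith

lemma rho_pos (p : ℝ) : 0 < rho p := by linarith [half_le_rho p]

lemma two_mul_le_log_one_div_rho (p : ℝ) : 2 * p * (1 - p) ≤ Real.log (1 / rho p) := by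
  have h := Real.log_le_sub_one_of_pos (rho_pos p)
  rw [one_div, Real.log_inv]
  have : rho p - 1 = -(2 * p * (1 - p)) := by unfold rho; ring
  linarith

lemma mainTerm_nonneg {p : ℝ} (h0 : 0 ≤ p) (h1 : p ≤ 1) (n : ℕ) : 0 ≤ mainTerm p n := by
  have h := two_mul_le_log_one_div_rho p
  have h2 : 0 ≤ 2 * p * (1 - p) := mul_nonneg (by linarith) (by linarith)
  have h3 : 0 ≤ Real.log n := Real.log_natCast_nonneg n
  unfold mainTerm
  have : 0 ≤ Real.log (1 / rho p) := h2.trans h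
  positivity

/-- The main term is the exponent for which `ρ ^ B = n⁻²`. -/
lemma rho_rpow_mul_mainTerm {p : ℝ} (h0 : 0 < p) (h1 : p < 1) {n : ℕ} (hn : 0 < n) (t : ℝ) :
    rho p ^ (t * mainTerm p n) = (n : ℝ) ^ (-(2 * t)) := by
  have hlog : Real.log (rho p) ≠ 0 := (Real.log_neg (rho_pos p) (rho_lt_one h0 h1)).ne
  rw [Real.rpow_def_of_pos (rho_pos p), Real.rpow_def_of_pos (by exact_mod_cast hn)]
  congr 1
  unfold mainTerm
  rw [one_div, Real.log_inv]
  field_simp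

lemma localizationNumber_le_of_copWins {V : Type*} {G : SimpleGraph V} {mayStay : Bool} {k : ℕ}
    (h : CopWins G mayStay k) : localizationNumber G mayStay ≤ k :=
  Nat.sInf_le h

lemma copWins_localizationNumber {V : Type*} [Fintype V] (G : SimpleGraph V) (mayStay : Bool) :
    CopWins G mayStay (localizationNumber G mayStay) :=
  Nat.sInf_mem (s := {k | CopWins G mayStay k}) ⟨_, copWins_card G mayStay⟩

lemma binomialRandom_real_localizationNumber_gt (mayStay : Bool) (p : I) (h0 : 0 < (p : ℝ))
    (h1 : (p : ℝ) < 1) {n : ℕ} (hn : 0 < n) {ε : ℝ} (hε : 0 < ε) :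
    (SimpleGraph.binomialRandom (Fin n) p).real
        {G | (1 + ε) * mainTerm p n < localizationNumber G mayStay} ≤
      2 * (n : ℝ) ^ (-(2 * ε)) := by
  have hB0 : 0 ≤ (1 + ε) * mainTerm p n :=
    mul_nonneg (by linarith) (mainTerm_nonneg h0.le h1.le n)
  have hn' : (0 : ℝ) < n := by exact_mod_cast hn
  set k := ⌊(1 + ε) * mainTerm p n⌋₊ with hk
  have hgt : ∀ G : SimpleGraph (Fin n), (1 + ε) * mainTerm p n < localizationNumber G mayStay →
      k < localizationNumber G mayStay := fun G hG =>
    (Nat.floor_lt hB0).2 hG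
  -- no set of `k` vertices exists if `n < k`, but `n` tests always suffice
  rcases le_or_gt n k with hnk | hnk
  · have hempty : {G : SimpleGraph (Fin n) |
        (1 + ε) * mainTerm p n < localizationNumber G mayStay} = ∅ := by
      refine Set.eq_empty_of_forall_notMem fun G hG => ?_
      have h2 := localizationNumber_le_of_copWins (copWins_card G mayStay)
      have h3 := hgt G hG
      rw [Fintype.card_fin] at h2
      omega
    rw [hempty, measureReal_empty]
    positivity
  obtain ⟨W, -, hW⟩ := Finset.exists_subset_card_eq (s := (Finset.univ : Finset (Fin n))) (n := k)
    (by simpa using hnk.le)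
  have hsub : {G : SimpleGraph (Fin n) |
      (1 + ε) * mainTerm p n < localizationNumber G mayStay} ⊆
      {G | ¬ ∀ u v, u ≠ v → u ∉ W → v ∉ W → ∃ w ∈ W, ¬ (G.Adj u w ↔ G.Adj v w)} := by
    intro G hG hsep
    have h2 := localizationNumber_le_of_copWins (copWins_of_separating mayStay hsep)
    have h3 := hgt G hG
    omega
  refine (measureReal_mono hsub).trans ((binomialRandom_real_not_separating p W).trans ?_)
  rw [hW, Fintype.card_fin]
  have hρk : rho p ^ k ≤ 2 * (n : ℝ) ^ (-(2 * (1 + ε))) := by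
    rw [← Real.rpow_natCast, ← rho_rpow_mul_mainTerm h0 h1 hn]
    calc rho p ^ (k : ℝ) ≤ rho p ^ ((1 + ε) * mainTerm p n - 1) :=
          Real.rpow_le_rpow_of_exponent_ge (rho_pos p) (rho_lt_one h0 h1).le
            (by linarith [Nat.lt_floor_add_one ((1 + ε) * mainTerm p n)])
      _ = (rho p)⁻¹ * rho p ^ ((1 + ε) * mainTerm p n) := by
          rw [Real.rpow_sub_one (rho_pos p).ne']; ring
      _ ≤ 2 * rho p ^ ((1 + ε) * mainTerm p n) := by
          refine mul_le_mul_of_nonneg_right ?_ (Real.rpow_nonneg (rho_pos p).le _)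
          rw [inv_le_comm₀ (rho_pos p) two_pos]
          linarith [half_le_rho p]
  calc (n : ℝ) ^ 2 * rho p ^ k ≤ (n : ℝ) ^ 2 * (2 * (n : ℝ) ^ (-(2 * (1 + ε)))) := by gcongr
    _ = 2 * (n : ℝ) ^ (-(2 * ε)) := by
        rw [← Real.rpow_natCast, mul_left_comm, ← Real.rpow_add hn']
        congr 2
        push_cast
        ring

/-- The lower bound, with the error terms measured by `X = n ^ (ε / 8)`. -/
lemma binomialRandom_real_localizationNumber_le (mayStay : Bool) (p : I) {n : ℕ} (hn : 6 ≤ n)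
    {ε c X : ℝ} (hε : 0 < ε) (hε1 : ε < 1) (hc : 0 < c) (hX : (n : ℝ) ^ ε = X ^ 8) (hX10 : 10 ≤ X)
    (hlog : Real.log n ≤ X) (hcX : 1 / c ≤ X) (hpX : X⁻¹ ≤ p) (hpc : (p : ℝ) ≤ 1 - c) :
    (SimpleGraph.binomialRandom (Fin n) p).real
        {G | (localizationNumber G mayStay : ℝ) ≤ (1 - ε) * mainTerm p n} ≤
      2 * Real.exp (-X) := by
  have hX0 : 0 < X := by linarith
  have h0 : 0 < (p : ℝ) := (inv_pos.2 hX0).trans_le hpX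
  have h1 : (p : ℝ) < 1 := by linarith
  have hn' : (6 : ℝ) ≤ n := by exact_mod_cast hn
  have hn0 : (0 : ℝ) < n := by linarith
  have hlog0 : 0 ≤ Real.log n := Real.log_natCast_nonneg n
  have hX8 : X ^ 8 ≤ n := by
    rw [← hX]
    exact (Real.rpow_le_rpow_of_exponent_le (by linarith) hε1.le).trans_eq (Real.rpow_one _)
  have hB0 : 0 ≤ mainTerm p n := mainTerm_nonneg h0.le h1.le n
  -- `B ≤ log n / (p c)`
  have hB : mainTerm p n ≤ X ^ 3 := by
    have h2 : 2 * (X⁻¹ * X⁻¹) ≤ Real.log (1 / rho p) := by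
      refine le_trans ?_ (two_mul_le_log_one_div_rho p)
      rw [mul_assoc]
      have h3 : X⁻¹ ≤ 1 - (p : ℝ) :=
        (by rw [inv_le_comm₀ hX0 hc]; simpa using hcX : X⁻¹ ≤ c).trans (by linarith)
      gcongr
    unfold mainTerm
    rw [div_le_iff₀ (lt_of_lt_of_le (by positivity) h2)]
    calc 2 * Real.log n ≤ 2 * X := by linarith
      _ = X ^ 3 * (2 * (X⁻¹ * X⁻¹)) := by field_simp
      _ ≤ _ := by gcongr
  have hB1 : 0 ≤ (1 - ε) * mainTerm p n := mul_nonneg (by linarith) hB0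
  have hB2 : (1 - ε) * mainTerm p n ≤ X ^ 3 := by nlinarith
  set K := ⌊(1 - ε) * mainTerm p n⌋₊ + 1 with hK
  have hK1 : (K : ℝ) ≤ (1 - ε) * mainTerm p n + 1 := by
    rw [hK]; push_cast; linarith [Nat.floor_le hB1]
  have hX38 : X ^ 3 + 1 ≤ X ^ 8 / 2 := by
    have h2 : (1 : ℝ) ≤ X ^ 3 := one_le_pow₀ (by linarith)
    have h3 : (10 : ℝ) ^ 5 ≤ X ^ 5 := by gcongr
    nlinarith
  set m := n / 4 with hm
  have hm8 : (n : ℝ) / 8 ≤ m := by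
    have : n ≤ 8 * m := by omega
    have : (n : ℝ) ≤ 8 * m := by exact_mod_cast this
    linarith
  have hmK : 2 * m + K ≤ n := by
    have h2 : (2 * K : ℝ) ≤ n := by linarith
    have h3 : 2 * K ≤ n := by exact_mod_cast h2
    omega
  have hy : (n : ℝ) ^ (-(1 - ε)) / 2 ≤ √(rho p ^ K) := by
    refine Real.le_sqrt_of_sq_le ?_
    calc ((n : ℝ) ^ (-(1 - ε)) / 2) ^ 2 = ((n : ℝ) ^ (-(1 - ε))) ^ 2 / 4 := by ring
      _ = (n : ℝ) ^ (-(2 * (1 - ε))) / 4 := by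
          rw [← Real.rpow_natCast, ← Real.rpow_mul hn0.le]
          congr 2
          push_cast
          ring
      _ ≤ rho p ^ ((1 - ε) * mainTerm p n) * rho p := by
          rw [← rho_rpow_mul_mainTerm h0 h1 (by omega)]
          have := Real.rpow_nonneg (rho_pos p).le ((1 - ε) * mainTerm p n)
          nlinarith [half_le_rho p]
      _ = rho p ^ ((1 - ε) * mainTerm p n + 1) := (Real.rpow_add_one (rho_pos p).ne' _).symm
      _ ≤ rho p ^ K := by
          rw [← Real.rpow_natCast]
          exact Real.rpow_le_rpow_of_exponent_ge (rho_pos p) (rho_lt_one h0 h1).le hK1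
  have hmy : X ^ 8 / 16 ≤ m * √(rho p ^ K) := by
    calc X ^ 8 / 16 = (n : ℝ) / 8 * ((n : ℝ) ^ (-(1 - ε)) / 2) := by
          have h2 : (n : ℝ) ^ ε = n * (n : ℝ) ^ (-(1 - ε)) := by
            rw [mul_comm, ← Real.rpow_add_one hn0.ne']
            congr 1
            ring
          rw [← hX, h2]; ring
      _ ≤ _ := by gcongr
  have hsub : {G : SimpleGraph (Fin n) |
      (localizationNumber G mayStay : ℝ) ≤ (1 - ε) * mainTerm p n} ⊆
      {G | ¬ ∀ u v, u ≠ v → (G.commonNeighbors u v).Nonempty} ∪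
      {G | ¬ ∀ W : Finset (Fin n), W.card = K → ∀ a ∈ W, HasTwins G W a} := by
    intro G hG
    by_contra hcon
    simp only [Set.mem_union, Set.mem_ofPred_eq, not_or, not_not] at hcon
    refine not_copWins_of_hasTwins mayStay ?_ ?_ hcon.1 hcon.2
      (copWins_localizationNumber G mayStay)
    · exact Nat.lt_succ_of_le (Nat.le_floor hG)
    · rw [Fintype.card_fin]; omega
  have hp2 : X⁻¹ ^ 2 ≤ (p : ℝ) ^ 2 := by gcongr
  have hX6 : (10 : ℝ) ^ 2 * X ^ 4 ≤ X ^ 6 := by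
    calc (10 : ℝ) ^ 2 * X ^ 4 ≤ X ^ 2 * X ^ 4 := by gcongr
      _ = X ^ 6 := by ring
  have hX4 : X ≤ X ^ 4 := le_self_pow₀ (by linarith) (by norm_num)
  have hX2 : X ^ 2 ≤ X ^ 4 := pow_le_pow_right₀ (by linarith) (by norm_num)
  have hdiam : (SimpleGraph.binomialRandom (Fin n) p).real
      {G | ¬ ∀ u v, u ≠ v → (G.commonNeighbors u v).Nonempty} ≤ Real.exp (-X) := by
    refine (binomialRandom_real_not_commonNeighbors p).trans ?_
    rw [Fintype.card_fin]
    have h2 : (1 - (p : ℝ) ^ 2) ^ (n - 2) ≤ Real.exp (-(p : ℝ) ^ 2) ^ (n - 2) :=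
      pow_le_pow_left₀ (by nlinarith) (by linarith [Real.add_one_le_exp (-(p : ℝ) ^ 2)]) _
    have h3 : (n : ℝ) ^ 2 = Real.exp (2 * Real.log n) := by
      rw [mul_comm, Real.exp_mul, Real.exp_log hn0]; norm_cast
    rw [← Real.exp_nat_mul] at h2
    rw [h3]
    refine (mul_le_mul_of_nonneg_left h2 (Real.exp_nonneg _)).trans ?_
    rw [← Real.exp_add, Real.exp_le_exp]
    have h4 : X ^ 6 / 2 ≤ ((n - 2 : ℕ) : ℝ) * (p : ℝ) ^ 2 := by
      calc X ^ 6 / 2 = X ^ 8 / 2 * X⁻¹ ^ 2 := by field_simp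
        _ ≤ ((n - 2 : ℕ) : ℝ) * (p : ℝ) ^ 2 := by
          have : X ^ 8 / 2 ≤ ((n - 2 : ℕ) : ℝ) := by
            rw [Nat.cast_sub (by omega)]; push_cast; linarith
          gcongr
    linarith
  have htwin : (SimpleGraph.binomialRandom (Fin n) p).real
      {G | ¬ ∀ W : Finset (Fin n), W.card = K → ∀ a ∈ W, HasTwins G W a} ≤ Real.exp (-X) := by
    refine (binomialRandom_real_not_forall_hasTwins p (m := m) (by simpa using hmK) ?_).trans ?_
    · have : (10 : ℝ) ^ 8 ≤ X ^ 8 := by gcongr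
      linarith
    rw [Fintype.card_fin]
    have h3 : (n : ℝ) ^ (K + 1) = Real.exp ((K + 1) * Real.log n) := by
      rw [mul_comm, Real.exp_mul, Real.exp_log hn0]; norm_cast
    rw [h3, ← Real.exp_add, Real.exp_le_exp]
    have h4 : (K + 1) * Real.log n ≤ (X ^ 3 + 2) * X := by
      have : (K : ℝ) + 1 ≤ X ^ 3 + 2 := by linarith
      gcongr
    have h5 : X ^ 6 / 16 ≤ (p : ℝ) ^ 2 * (m * √(rho p ^ K)) := by
      calc X ^ 6 / 16 = X⁻¹ ^ 2 * (X ^ 8 / 16) := by field_simp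
        _ ≤ _ := by gcongr
    have h6 : (X ^ 3 + 2) * X = X ^ 4 + 2 * X := by ring
    have h7 : 10 * X ≤ X ^ 4 := by
      calc 10 * X ≤ X * X := by gcongr
        _ = X ^ 2 := by ring
        _ ≤ X ^ 4 := hX2
    linarith
  refine (measureReal_mono hsub).trans ((measureReal_union_le _ _).trans ?_)
  linarith

end Bounds

/-! ### Asymptotics -/

section Asymptotics

open MeasureTheory unitInterval

/-- The concentration result for all `p` that are `n ^ (-o(1))` and bounded away from `1`. -/
theorem aasApprox_localizationNumber (mayStay : Bool) {p : ℕ → I}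
    (hp0 : ∀ δ : ℝ, 0 < δ → ∀ᶠ n : ℕ in atTop, (n : ℝ) ^ (-δ) ≤ p n)
    {c : ℝ} (hc : 0 < c) (hp1 : ∀ᶠ n : ℕ in atTop, (p n : ℝ) ≤ 1 - c) :
    AasApprox p (fun _ G => (localizationNumber G mayStay : ℝ)) (fun n => mainTerm (p n) n) := by
  intro ε₀ hε₀
  set ε := min ε₀ (1 / 2) with hε
  have hε0 : 0 < ε := lt_min hε₀ (by norm_num)
  have hε1 : ε < 1 := (min_le_right _ _).trans_lt (by norm_num)
  have hnat := tendsto_natCast_atTop_atTop (R := ℝ)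
  have hXtop : Tendsto (fun n : ℕ => (n : ℝ) ^ (ε / 8)) atTop atTop :=
    (tendsto_rpow_atTop (by positivity)).comp hnat
  have hlim : Tendsto (fun n : ℕ => ENNReal.ofReal
      (1 - (2 * (n : ℝ) ^ (-(2 * ε)) + 2 * Real.exp (-(n : ℝ) ^ (ε / 8))))) atTop (𝓝 1) := by
    have h1 : Tendsto (fun n : ℕ => (n : ℝ) ^ (-(2 * ε))) atTop (𝓝 0) :=
      (tendsto_rpow_neg_atTop (by positivity)).comp hnat
    have h2 : Tendsto (fun n : ℕ => Real.exp (-(n : ℝ) ^ (ε / 8))) atTop (𝓝 0) :=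
      Real.tendsto_exp_neg_atTop_nhds_zero.comp hXtop
    have h3 := ENNReal.tendsto_ofReal
      (((h1.const_mul 2).add (h2.const_mul 2)).const_sub (1 : ℝ))
    simpa using h3
  refine tendsto_of_tendsto_of_tendsto_of_le_of_le' hlim tendsto_const_nhds ?_
    (Eventually.of_forall fun n => prob_le_one)
  have hlogX : ∀ᶠ n : ℕ in atTop, Real.log n ≤ (n : ℝ) ^ (ε / 8) := by
    have h := ((isLittleO_log_rpow_atTop (show 0 < ε / 8 by positivity)).bound one_pos)
    filter_upwards [hnat.eventually h] with n hn
    rw [one_mul, Real.norm_of_nonneg (show 0 ≤ (n : ℝ) ^ (ε / 8) by positivity)] at hn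
    exact (le_abs_self _).trans hn
  filter_upwards [hp0 (ε / 8) (by positivity), hp1, eventually_ge_atTop 6,
    hXtop.eventually_ge_atTop 10, hXtop.eventually_ge_atTop (1 / c), hlogX]
    with n h0 h1 hn hX10 hcX hlog
  have hn0 : (0 : ℝ) < n := by exact_mod_cast (show 0 < n by omega)
  rw [Real.rpow_neg hn0.le] at h0
  have hp0' : 0 < (p n : ℝ) := lt_of_lt_of_le (by positivity) h0
  have hX8 : (n : ℝ) ^ ε = ((n : ℝ) ^ (ε / 8)) ^ 8 := by
    rw [← Real.rpow_natCast, ← Real.rpow_mul hn0.le]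
    congr 1
    push_cast
    ring
  set μ := SimpleGraph.binomialRandom (Fin n) (p n)
  set B := mainTerm (p n) n with hB
  have hB0 : 0 ≤ B := mainTerm_nonneg hp0'.le (by linarith) n
  have hup := binomialRandom_real_localizationNumber_gt mayStay (p n) hp0' (by linarith)
    (show 0 < n by omega) hε0
  have hlow := binomialRandom_real_localizationNumber_le mayStay (p n) hn hε0 hε1 hc hX8 hX10 hlog
    hcX h0 h1
  set good := {G : SimpleGraph (Fin n) | |(localizationNumber G mayStay : ℝ) - B| ≤ ε₀ * |B|}
  have hcover : (Set.univ : Set (SimpleGraph (Fin n))) ⊆ good ∪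
      ({G | (1 + ε) * B < localizationNumber G mayStay} ∪
        {G | (localizationNumber G mayStay : ℝ) ≤ (1 - ε) * B}) := by
    intro G _
    by_contra hcon
    simp only [Set.mem_union, Set.mem_ofPred_eq, not_or, not_le, not_lt] at hcon
    obtain ⟨h2, h3, h4⟩ := hcon
    refine h2 ?_
    have h5 : ε * B ≤ ε₀ * |B| := by
      rw [abs_of_nonneg hB0]
      exact mul_le_mul_of_nonneg_right (min_le_left _ _) hB0
    refine le_trans ?_ h5
    rw [abs_le]
    constructor <;> linarith
  have hreal : 1 ≤ μ.real good +
      (2 * (n : ℝ) ^ (-(2 * ε)) + 2 * Real.exp (-(n : ℝ) ^ (ε / 8))) := by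
    calc (1 : ℝ) = μ.real Set.univ := probReal_univ.symm
      _ ≤ _ := measureReal_mono hcover
      _ ≤ _ := measureReal_union_le _ _
      _ ≤ _ := by
        gcongr
        exact (measureReal_union_le _ _).trans (add_le_add hup hlow)
  rw [← ofReal_measureReal (measure_ne_top μ good)]
  exact ENNReal.ofReal_le_ofReal (by linarith)

lemma tendsto_eta {p : ℕ → I}
    (hp0 : ∀ δ : ℝ, 0 < δ → ∀ᶠ n : ℕ in atTop, (n : ℝ) ^ (-δ) ≤ p n) :
    Tendsto (fun n => eta (p n) n) atTop (𝓝 0) := by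
  rw [Metric.tendsto_nhds]
  intro ε hε
  filter_upwards [hp0 (ε / 2) (by positivity), eventually_ge_atTop 2] with n h hn
  have hn1 : (1 : ℝ) < n := by exact_mod_cast (show 1 < n by omega)
  have hlog : 0 < Real.log n := Real.log_pos hn1
  have hp : 0 < (p n : ℝ) := lt_of_lt_of_le (by positivity) h
  have h2 : Real.log (1 / p n) ≤ ε / 2 * Real.log n := by
    have h3 := Real.log_le_log (by positivity) h
    rw [Real.log_rpow (by linarith)] at h3
    rw [one_div, Real.log_inv]
    linarith
  have h4 : 0 ≤ Real.log (1 / p n) := Real.log_nonneg (by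
    rw [le_div_iff₀ hp, one_mul]; exact (p n).2.2)
  rw [Real.dist_eq, sub_zero, eta, abs_of_nonneg (by positivity), div_lt_iff₀ hlog]
  nlinarith

/-- Both bounds are `(1 + o(1))` times the main term. -/
theorem lowerBound_isEquivalent_upperBound {p : ℕ → I}
    (hp0 : ∀ δ : ℝ, 0 < δ → ∀ᶠ n : ℕ in atTop, (n : ℝ) ^ (-δ) ≤ p n) (c : ℝ) :
    (fun n : ℕ => lowerBound (p n) n) ~[atTop] (fun n : ℕ => upperBound c (p n) n) := by
  have hη := tendsto_eta hp0
  have hloglog : Tendsto (fun n : ℕ => Real.log (Real.log n) / Real.log n) atTop (𝓝 0) :=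
    (Real.isLittleO_log_id_atTop.tendsto_div_nhds_zero).comp
      (Real.tendsto_log_atTop.comp tendsto_natCast_atTop_atTop)
  have h1 : Tendsto (fun n : ℕ => 1 - 2 * eta (p n) n - 4 * Real.log (Real.log n) / Real.log n)
      atTop (𝓝 1) := by
    have h := ((hη.const_mul 2).const_sub 1).sub (hloglog.const_mul 4)
    simpa [mul_div_assoc] using h
  have h2 : Tendsto (fun n : ℕ => 1 - c * eta (p n) n) atTop (𝓝 1) := by
    simpa using (hη.const_mul c).const_sub 1
  exact (((isEquivalent_const_iff_tendsto one_ne_zero).2 h1).trans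
    ((isEquivalent_const_iff_tendsto one_ne_zero).2 h2).symm).mul IsEquivalent.refl

end Asymptotics
end LocalizationGame

theorem mainTheorem3 (mayStay : Bool) :
    -- the case `p = n ^ (-1/ω)`, where `ω → ∞` and `ω = o(log n)`
    (∀ (ω : ℕ → ℝ) (p : ℕ → unitInterval),
      Tendsto ω atTop atTop →
      ω =o[atTop] (fun n : ℕ => Real.log n) →
      (∀ᶠ n : ℕ in atTop, (p n : ℝ) = (n : ℝ) ^ (-(1 / ω n))) →
        (∀ c : ℝ, 0 < c → c < 1 →
          (fun n : ℕ => LocalizationGame.lowerBound (p n) n) ~[atTop]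
            (fun n : ℕ => LocalizationGame.upperBound c (p n) n)) ∧
        LocalizationGame.AasApprox p
          (fun _ G => (LocalizationGame.localizationNumber G mayStay : ℝ))
          (fun n : ℕ => LocalizationGame.mainTerm (p n) n)) ∧
    -- the case of a constant `p`
    (∀ p : unitInterval, 0 < (p : ℝ) → (p : ℝ) < 1 →
        (∀ c : ℝ, 0 < c → c < 1 →
          (fun n : ℕ => LocalizationGame.lowerBound p n) ~[atTop]
            (fun n : ℕ => LocalizationGame.upperBound c p n)) ∧
        LocalizationGame.AasApprox (fun _ => p)
          (fun _ G => (LocalizationGame.localizationNumber G mayStay : ℝ))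
          (fun n : ℕ => LocalizationGame.mainTerm p n)) := by
  constructor
  · intro ω p hω hωlog hp
    have hp0 : ∀ δ : ℝ, 0 < δ → ∀ᶠ n : ℕ in atTop, (n : ℝ) ^ (-δ) ≤ p n := by
      intro δ hδ
      filter_upwards [hp, hω.eventually_ge_atTop (1 / δ), hω.eventually_gt_atTop 0,
        eventually_ge_atTop 1] with n hpn hωn hω0 hn
      rw [hpn]
      refine Real.rpow_le_rpow_of_exponent_le (by exact_mod_cast hn) (neg_le_neg ?_)
      rw [div_le_iff₀ hω0]
      rwa [div_le_iff₀' hδ] at hωn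
    have hp1 : ∀ᶠ n : ℕ in atTop, (p n : ℝ) ≤ 1 - (1 - Real.exp (-1)) := by
      filter_upwards [hp, hωlog.bound one_pos, hω.eventually_gt_atTop 0,
        eventually_ge_atTop 1] with n hpn hωn hω0 hn
      have hlog : 0 ≤ Real.log n := Real.log_natCast_nonneg n
      rw [one_mul, Real.norm_of_nonneg hω0.le, Real.norm_of_nonneg hlog] at hωn
      rw [hpn, Real.rpow_def_of_pos (by exact_mod_cast hn), sub_sub_cancel, Real.exp_le_exp,
        mul_neg, neg_le_neg_iff, mul_one_div, le_div_iff₀ hω0, one_mul]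
      exact hωn
    have he : Real.exp (-1) < 1 := (Real.exp_lt_exp.2 (by norm_num)).trans_eq Real.exp_zero
    exact ⟨fun c _ _ => LocalizationGame.lowerBound_isEquivalent_upperBound hp0 c,
      LocalizationGame.aasApprox_localizationNumber mayStay hp0 (sub_pos.2 he) hp1⟩
  · intro p h0 h1
    have hp0 : ∀ δ : ℝ, 0 < δ → ∀ᶠ n : ℕ in atTop, (n : ℝ) ^ (-δ) ≤ p := fun δ hδ =>
      ((tendsto_rpow_neg_atTop hδ).comp tendsto_natCast_atTop_atTop).eventually_le_const h0
    exact ⟨fun c _ _ => LocalizationGame.lowerBound_isEquivalent_upperBound (p := fun _ => p) hp0 c,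
      LocalizationGame.aasApprox_localizationNumber mayStay (p := fun _ => p) hp0 (sub_pos.2 h1)
        (Eventually.of_forall fun _ => (sub_sub_cancel 1 (p : ℝ)).ge)⟩
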